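/- Let $\Bbbk$ be an algebraically closed field. A Kronecker module $M$ is a finite-dimensional representation $M(\alpha),M(\beta)\colon M(1)\rightrightarrows M(2)$ of the quiver with two vertices $1,2$ and two arrows $\alpha,\beta\colon 1\to 2$; put $d_2:=\dim M(2)$. Write a module with underlying spaces $\Bbbk^{m},\Bbbk^{n}$ as the pair of its $n\times m$ matrices. Let $E_n$ be the identity matrix, $J_n(\lambda)$ the $n \times n$ Jordan cell with eigenvalue $\lambda$, and $\mathbf 0$ the zero column of length $n-1$. For $n\ge 1$ and $\lambda\in\Bbbk$ put $$P_n:=\left(\begin{bmatrix}E_{n-1}\\ {}^t\mathbf 0\end{bmatrix},\begin{bmatrix}{}^t\mathbf 0\\ E_{n-1}\end{bmatrix}\right),\quad I_n:=([E_{n-1},\mathbf 0],[\mathbf 0,E_{n-1}]),\quad R_n(\lambda):=(E_n,J_n(\lambda)),\quad R_n(\infty):=(J_n(0),E_n),$$ and let $P_0:=0$. These modules ($n\ge 1$) are called preprojective ($P_n$), preinjective ($I_n$) and regular ($R_n(\lambda)$, $\lambda\in\Bbbk\cup\{\infty\}$), respectively. For every Kronecker module $M$ there is an isomorphism $F\colon\bigoplus_{j=1}^r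 L_j\to M$ with each $L_j$ one of these modules. Moreover, for every such $F$, let $P_M$, $R_M$ and $I_M$ be the images under $F$ of the sums of the preprojective, the regular and the preinjective $L_j$, respectively, so that $M=P_M\oplus R_M\oplus I_M$. If $f_1,\dots,f_a$ is a basis of $\operatorname{Hom}(M,P_{d_2})$, then $$\bigcap_{i=1}^a\operatorname{Ker} f_i=\operatorname{Rej}_M(P_{d_2})=R_M\oplus I_M,$$ where $\operatorname{Rej}_M(U):=\bigcap\{\operatorname{Ker} f\mid f\in\operatorname{Hom}(M,U)\}$, and hence $$P_M\cong M\Big/\bigcap_{i=1}^a\operatorname{Ker} f_i .$$ (For $a=0$ the intersection is $M$.) -/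

import Mathlib

universe u v w

/-- A finite-dimensional representation over `k` of the Kronecker quiver, which has two vertices
`1`, `2` and two arrows `α, β : 1 → 2`; equivalently, a finite-dimensional left module over the
Kronecker algebra. -/
structure KroneckerRep (k : Type u) [Field k] where
  V₁ : Type v
  V₂ : Type v
  [addCommGroup₁ : AddCommGroup V₁]
  [addCommGroup₂ : AddCommGroup V₂]
  [module₁ : Module k V₁]
  [module₂ : Module k V₂]
  [finite₁ : FiniteDimensional k V₁]
  [finite₂ : FiniteDimensional k V₂]
  α : V₁ →ₗ[k] V₂
  β : V₁ →ₗ[k] V₂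

namespace KroneckerRep

attribute [instance] addCommGroup₁ addCommGroup₂ module₁ module₂ finite₁ finite₂

section General

variable {k : Type u} [Field k]

/-- The space `Hom(M, N)` of morphisms of representations: pairs `(f₁, f₂)` of linear maps with
`f₂ α = α f₁` and `f₂ β = β f₁`. It is a `k`-vector space. -/
def Hom (M : KroneckerRep.{u, v} k) (N : KroneckerRep.{u, w} k) :
    Submodule k ((M.V₁ →ₗ[k] N.V₁) × (M.V₂ →ₗ[k] N.V₂)) where
  carrier := {f | f.2 ∘ₗ M.α = N.α ∘ₗ f.1 ∧ f.2 ∘ₗ M.β = N.β ∘ₗ f.1}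
  zero_mem' := by simp
  add_mem' := by
    rintro f g ⟨hf, hf'⟩ ⟨hg, hg'⟩
    simp [LinearMap.add_comp, LinearMap.comp_add, hf, hf', hg, hg']
  smul_mem' := by
    rintro c f ⟨hf, hf'⟩
    simp [LinearMap.smul_comp, LinearMap.comp_smul, hf, hf']

/-- An isomorphism of representations. -/
structure Iso (M : KroneckerRep.{u, v} k) (N : KroneckerRep.{u, w} k) where
  e₁ : M.V₁ ≃ₗ[k] N.V₁
  e₂ : M.V₂ ≃ₗ[k] N.V₂
  comm_α : ∀ x, e₂ (M.α x) = N.α (e₁ x)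
  comm_β : ∀ x, e₂ (M.β x) = N.β (e₁ x)

/-- A subrepresentation (submodule) of `M`. -/
@[ext]
structure Subrep (M : KroneckerRep.{u, v} k) where
  U₁ : Submodule k M.V₁
  U₂ : Submodule k M.V₂
  map_α : ∀ x ∈ U₁, M.α x ∈ U₂
  map_β : ∀ x ∈ U₁, M.β x ∈ U₂

namespace Subrep

variable {M : KroneckerRep.{u, v} k}

/-- The underlying pair of subspaces. -/
def toProd (N : Subrep M) : Submodule k M.V₁ × Submodule k M.V₂ := (N.U₁, N.U₂)

theorem toProd_injective : Function.Injective (toProd (M := M)) := by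
  intro N N' h
  exact Subrep.ext (congrArg Prod.fst h) (congrArg Prod.snd h)

/-- Inclusion of subrepresentations, vertex by vertex. -/
instance : LE (Subrep M) := ⟨fun N N' => N.U₁ ≤ N'.U₁ ∧ N.U₂ ≤ N'.U₂⟩

instance : LT (Subrep M) := ⟨fun N N' => N ≤ N' ∧ ¬ N' ≤ N⟩

/-- The sum of two subrepresentations. -/
instance : Max (Subrep M) :=
  ⟨fun N N' => ⟨N.U₁ ⊔ N'.U₁, N.U₂ ⊔ N'.U₂,
    fun x hx => by
      have h : N.U₁ ⊔ N'.U₁ ≤ (N.U₂ ⊔ N'.U₂).comap M.α :=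
        sup_le (fun y hy => Submodule.mem_sup_left (N.map_α y hy))
          (fun y hy => Submodule.mem_sup_right (N'.map_α y hy))
      exact h hx,
    fun x hx => by
      have h : N.U₁ ⊔ N'.U₁ ≤ (N.U₂ ⊔ N'.U₂).comap M.β :=
        sup_le (fun y hy => Submodule.mem_sup_left (N.map_β y hy))
          (fun y hy => Submodule.mem_sup_right (N'.map_β y hy))
      exact h hx⟩⟩

/-- The intersection of two subrepresentations. -/
instance : Min (Subrep M) :=
  ⟨fun N N' => ⟨N.U₁ ⊓ N'.U₁, N.U₂ ⊓ N'.U₂,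
    fun x hx => ⟨N.map_α x hx.1, N'.map_α x hx.2⟩,
    fun x hx => ⟨N.map_β x hx.1, N'.map_β x hx.2⟩⟩⟩

/-- The sum of a set of subrepresentations. -/
instance : SupSet (Subrep M) :=
  ⟨fun s => ⟨⨆ N ∈ s, N.U₁, ⨆ N ∈ s, N.U₂,
    fun x hx => by
      have h : (⨆ N ∈ s, N.U₁) ≤ (⨆ N ∈ s, N.U₂).comap M.α :=
        iSup₂_le fun N hN y hy =>
          (le_iSup₂ (f := fun (N : Subrep M) (_ : N ∈ s) => N.U₂) N hN) (N.map_α y hy)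
      exact h hx,
    fun x hx => by
      have h : (⨆ N ∈ s, N.U₁) ≤ (⨆ N ∈ s, N.U₂).comap M.β :=
        iSup₂_le fun N hN y hy =>
          (le_iSup₂ (f := fun (N : Subrep M) (_ : N ∈ s) => N.U₂) N hN) (N.map_β y hy)
      exact h hx⟩⟩

/-- The intersection of a set of subrepresentations; that of the empty set is `M`. -/
instance : InfSet (Subrep M) :=
  ⟨fun s => ⟨⨅ N ∈ s, N.U₁, ⨅ N ∈ s, N.U₂,
    fun x hx => by
      simp only [Submodule.mem_iInf] at hx ⊢
      exact fun N hN => N.map_α x (hx N hN),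
    fun x hx => by
      simp only [Submodule.mem_iInf] at hx ⊢
      exact fun N hN => N.map_β x (hx N hN)⟩⟩

instance : Top (Subrep M) := ⟨⟨⊤, ⊤, fun _ _ => trivial, fun _ _ => trivial⟩⟩

instance : Bot (Subrep M) :=
  ⟨⟨⊥, ⊥, fun x hx => by simp [(Submodule.mem_bot k).1 hx],
    fun x hx => by simp [(Submodule.mem_bot k).1 hx]⟩⟩

instance : CompleteLattice (Subrep M) :=
  toProd_injective.completeLattice toProd Iff.rfl Iff.rfl
    (fun _ _ => rfl) (fun _ _ => rfl)
    (fun s => by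
      refine Prod.ext ?_ ?_
      · simp only [Prod.fst_iSup]; rfl
      · simp only [Prod.snd_iSup]; rfl)
    (fun s => by
      refine Prod.ext ?_ ?_
      · simp only [Prod.fst_iInf]; rfl
      · simp only [Prod.snd_iInf]; rfl)
    rfl rfl

/-- A subrepresentation, viewed as a representation. -/
def toRep (N : Subrep M) : KroneckerRep.{u, v} k where
  V₁ := N.U₁
  V₂ := N.U₂
  α := M.α.restrict N.map_α
  β := M.β.restrict N.map_β

/-- The image of a subrepresentation under an isomorphism. -/
def map {M' : KroneckerRep.{u, w} k} (F : Iso M M') (N : Subrep M) : Subrep M' where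
  U₁ := N.U₁.map F.e₁.toLinearMap
  U₂ := N.U₂.map F.e₂.toLinearMap
  map_α := by
    rintro _ ⟨x, hx, rfl⟩
    exact ⟨M.α x, N.map_α x hx, F.comm_α x⟩
  map_β := by
    rintro _ ⟨x, hx, rfl⟩
    exact ⟨M.β x, N.map_β x hx, F.comm_β x⟩

end Subrep

/-- The quotient representation `M / N`. -/
def quotient (M : KroneckerRep.{u, v} k) (N : Subrep M) : KroneckerRep.{u, v} k where
  V₁ := M.V₁ ⧸ N.U₁
  V₂ := M.V₂ ⧸ N.U₂
  α := N.U₁.mapQ N.U₂ M.α N.map_α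
  β := N.U₁.mapQ N.U₂ M.β N.map_β

/-- The kernel of a morphism. -/
def ker {M : KroneckerRep.{u, v} k} {N : KroneckerRep.{u, w} k} (f : Hom M N) : Subrep M where
  U₁ := LinearMap.ker f.1.1
  U₂ := LinearMap.ker f.1.2
  map_α := fun x hx => by
    have h : f.1.2 (M.α x) = N.α (f.1.1 x) := LinearMap.congr_fun f.2.1 x
    rw [LinearMap.mem_ker] at hx ⊢
    rw [h, hx, map_zero]
  map_β := fun x hx => by
    have h : f.1.2 (M.β x) = N.β (f.1.1 x) := LinearMap.congr_fun f.2.2 x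
    rw [LinearMap.mem_ker] at hx ⊢
    rw [h, hx, map_zero]

/-- The reject `Rej_M(U)`: the intersection of the kernels of all morphisms `M → U`. -/
def reject (M : KroneckerRep.{u, v} k) (U : KroneckerRep.{u, w} k) : Subrep M :=
  ⨅ f : Hom M U, ker f

/-- The direct sum of a finite family of representations. -/
def directSum {r : ℕ} (N : Fin r → KroneckerRep.{u, v} k) : KroneckerRep.{u, v} k where
  V₁ := ∀ j, (N j).V₁
  V₂ := ∀ j, (N j).V₂
  α := LinearMap.piMap fun j => (N j).α
  β := LinearMap.piMap fun j => (N j).β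

/-- The partial sum of the summands with index in `S`, inside the direct sum. -/
def partialSum {r : ℕ} (N : Fin r → KroneckerRep.{u, v} k) (S : Set (Fin r)) :
    Subrep (directSum N) where
  U₁ := Submodule.pi Sᶜ fun _ => ⊥
  U₂ := Submodule.pi Sᶜ fun _ => ⊥
  map_α := fun x hx j hj => by
    have h : x j = 0 := hx j hj
    change (N j).α (x j) = 0
    rw [h, map_zero]
  map_β := fun x hx j hj => by
    have h : x j = 0 := hx j hj
    change (N j).β (x j) = 0
    rw [h, map_zero]

end General

section Indecomposables

variable (k : Type u) [Field k]

/-- The representation `(A, B) : k ^ d₁ ⇉ k ^ d₂` given by two `d₂ × d₁` matrices. -/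
def ofMatrices {k : Type u} [Field k] {d₁ d₂ : ℕ} (A B : Matrix (Fin d₂) (Fin d₁) k) :
    KroneckerRep.{u, u} k where
  V₁ := Fin d₁ → k
  V₂ := Fin d₂ → k
  α := A.mulVecLin
  β := B.mulVecLin

/-- The preprojective `P_n`, of dimension vector `(n - 1, n)`: `α` is the identity matrix with a
zero row added at the bottom, `β` the identity matrix with a zero row added at the top.
For `n = 0` this is the zero representation. -/
def preproj (n : ℕ) : KroneckerRep.{u, u} k :=
  ofMatrices (d₁ := n - 1) (d₂ := n)
    (Matrix.of fun i j => if (i : ℕ) = j then 1 else 0)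
    (Matrix.of fun i j => if (i : ℕ) = j + 1 then 1 else 0)

/-- The preinjective `I_n`, of dimension vector `(n, n - 1)`: `α` is the identity matrix with a
zero column added on the right, `β` the identity matrix with a zero column added on the left. -/
def preinj (n : ℕ) : KroneckerRep.{u, u} k :=
  ofMatrices (d₁ := n) (d₂ := n - 1)
    (Matrix.of fun i j => if (j : ℕ) = i then 1 else 0)
    (Matrix.of fun i j => if (j : ℕ) = i + 1 then 1 else 0)

variable {k} in
/-- The Jordan cell `J_n(c)` of size `n` with eigenvalue `c`. -/
def jordanCell (n : ℕ) (c : k) : Matrix (Fin n) (Fin n) k :=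
  Matrix.of fun i j => if i = j then c else if (j : ℕ) = i + 1 then 1 else 0

variable {k} in
/-- The regular `R_n(c) = (E_n, J_n(c))` with parameter `c ∈ k`. -/
def regular (n : ℕ) (c : k) : KroneckerRep.{u, u} k :=
  ofMatrices (1 : Matrix (Fin n) (Fin n) k) (jordanCell n c)

/-- The regular `R_n(∞) = (J_n(0), E_n)`. -/
def regularInfty (n : ℕ) : KroneckerRep.{u, u} k :=
  ofMatrices (jordanCell n (0 : k)) (1 : Matrix (Fin n) (Fin n) k)

/-- Names for the members of the list of indecomposables: `P_n`, `I_n`, `R_n(c)` with `c ∈ k`, and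
`R_n(∞)`, each with `n ≥ 1`. -/
inductive Label (k : Type u) : Type u
  | P (n : ℕ+)
  | I (n : ℕ+)
  | R (n : ℕ+) (c : k)
  | Rinfty (n : ℕ+)

namespace Label

variable {k}

/-- The indecomposable representation with a given name. -/
def rep : Label k → KroneckerRep.{u, u} k
  | P n => preproj k n
  | I n => preinj k n
  | R n c => regular n c
  | Rinfty n => regularInfty k n

/-- The label names a preprojective indecomposable. -/
def IsPreprojective : Label k → Prop
  | P _ => True
  | _ => False

/-- The label names a regular indecomposable. -/
def IsRegular : Label k → Prop
  | R _ _ => True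
  | Rinfty _ => True
  | _ => False

/-- The label names a preinjective indecomposable. -/
def IsPreinjective : Label k → Prop
  | I _ => True
  | _ => False

end Label

/-- An indecomposable decomposition of `M`: a finite family of members of the list, in which each
`L` occurs as often as its multiplicity in `M`, together with an isomorphism `F` from the direct
sum of the family to `M`. -/
structure Decomposition {k : Type u} [Field k] (M : KroneckerRep.{u, v} k) where
  r : ℕ
  label : Fin r → Label k
  F : Iso (directSum fun j => (label j).rep) M

namespace Decomposition

variable {k} {M : KroneckerRep.{u, v} k} (D : Decomposition M)

/-- The preprojective part `P_M`: the image under `F` of the sum of the preprojective summands. -/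
def preprojectivePart : Subrep M :=
  (partialSum (fun j => (D.label j).rep) {j | (D.label j).IsPreprojective}).map D.F

/-- The regular part `R_M`: the image under `F` of the sum of the regular summands. -/
def regularPart : Subrep M :=
  (partialSum (fun j => (D.label j).rep) {j | (D.label j).IsRegular}).map D.F

/-- The preinjective part `I_M`: the image under `F` of the sum of the preinjective summands. -/
def preinjectivePart : Subrep M :=
  (partialSum (fun j => (D.label j).rep) {j | (D.label j).IsPreinjective}).map D.F

end Decomposition

end Indecomposables

end KroneckerRep

/-! Existence of decompositions. By induction on the total dimension it suffices to find, for
nonzero `M`, a listed `L` with morphisms `s : L → M` and `r : M → L` such that `r ∘ s` is injective,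
hence bijective; then `M = s(L) ⊕ ker r`. Such an `L` comes from an extremal chain
(`exists_isRetract_label`). A shortest kernel chain of the pencil gives some `I_n`, a shortest one
of the transposed pencil some `P_n`. If neither exists, `exists_isKernelChain_of_finrank_lt` makes
the two dimensions equal, and a longest Jordan chain gives `R_n(∞)` if `α` is singular, and
otherwise `R_n(c)` for an eigenvalue `c` of `α⁻¹β`; only this eigenvalue needs an algebraically
closed field. The chain gives one of `s`, `r`; its extremality gives the other through a dual
sequence, and the pairing of the two sequences is a unitriangular Toeplitz matrix, up to
transposition.

The reject. No nonzero morphism goes from `I_n` or a regular module to `P_d`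
(`Label.hom_preproj_eq_zero`), whereas `P_n` embeds into `P_d` for `n ≤ d`, and every summand `P_n`
of `M` has `n ≤ d₂`. So the common kernel of all morphisms to `P_{d₂}` is `R_M ⊕ I_M`. A basis of
morphisms has the same common kernel, and its complement `P_M` is isomorphic to the quotient. -/

namespace KroneckerRep

/-! ### Linear relations, chains of a pencil, and their dual sequences. -/

section LinearRelations

variable {k : Type u} [Field k] {V : Type v} {W : Type w} [AddCommGroup V] [AddCommGroup W]
  [Module k V] [Module k W]

/-- `ψ` kills the kernel of `V → W ⧸ Z`, and a functional that kills the kernel of a linear map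
factors through that map. -/
theorem exists_dual_comp_eq (α : V →ₗ[k] W) (Z : Submodule k W) (ψ : Module.Dual k V)
    (h : ∀ x, α x ∈ Z → ψ x = 0) :
    ∃ φ : Module.Dual k W, (∀ x, φ (α x) = ψ x) ∧ ∀ z ∈ Z, φ z = 0 := by
  have hψ : ψ ∈ LinearMap.range (Z.mkQ ∘ₗ α).dualMap := by
    rw [LinearMap.range_dualMap_eq_dualAnnihilator_ker, Submodule.mem_dualAnnihilator]
    intro x hx
    apply h
    simpa using hx
  obtain ⟨χ, hχ⟩ := hψ
  refine ⟨χ ∘ₗ Z.mkQ, fun x => by rw [← hχ]; rfl, fun z hz => ?_⟩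
  simp [(Submodule.Quotient.mk_eq_zero Z).2 hz]

theorem exists_dual_eq_one {U : Submodule k V} {x : V} (hx : x ∉ U) :
    ∃ ψ : Module.Dual k V, ψ x = 1 ∧ ∀ y ∈ U, ψ y = 0 := by
  obtain ⟨f, hf, hU⟩ := Submodule.exists_le_ker_of_notMem hx
  refine ⟨(f x)⁻¹ • f, by simp [hf], fun y hy => ?_⟩
  have : f y = 0 := hU hy
  simp [this]

/-- The iterated preimages of `U` under the linear relation `α x = β x'` on `V`. -/
def sourceIter (α β : V →ₗ[k] W) (U : Submodule k V) : ℕ → Submodule k V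
  | 0 => U
  | m + 1 => ((sourceIter α β U m).map β).comap α

/-- The iterated preimages of `Y` under the linear relation `(α x, β x)` on `W`. -/
def targetIter (α β : V →ₗ[k] W) (Y : Submodule k W) : ℕ → Submodule k W
  | 0 => Y
  | m + 1 => ((targetIter α β Y m).comap β).map α

theorem exists_seq_of_mem_sourceIter (α β : V →ₗ[k] W) (U : Submodule k V) (m : ℕ) {x : V}
    (hx : x ∈ sourceIter α β U m) :
    ∃ z : ℕ → V, z 0 = x ∧ (∀ i < m, α (z i) = β (z (i + 1))) ∧ z m ∈ U := by
  induction m generalizing x with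
  | zero => exact ⟨fun _ => x, rfl, by simp, hx⟩
  | succ m ih =>
    obtain ⟨x', hx', he⟩ := hx
    obtain ⟨z, h0, hz, hm⟩ := ih hx'
    refine ⟨fun i => Nat.casesOn i x z, rfl, ?_, hm⟩
    rintro (_ | i) hi
    · simpa [h0] using he.symm
    · exact hz i (by omega)

/-- The obstruction dual to `exists_seq_of_mem_sourceIter`: each functional is factored through `α`
by `exists_dual_comp_eq`, then pulled back along `β`. -/
theorem exists_dual_seq_of_sourceIter (α β : V →ₗ[k] W) (U : Submodule k V) (m : ℕ)
    (ψ : Module.Dual k V) (hψ : ∀ x ∈ sourceIter α β U m, ψ x = 0) :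
    ∃ (p : ℕ → Module.Dual k V) (q : ℕ → Module.Dual k W), p 0 = ψ ∧
      (∀ i < m, ∀ x, q i (α x) = p i x) ∧ (∀ i < m, ∀ x, q i (β x) = p (i + 1) x) ∧
      ∀ x ∈ U, p m x = 0 := by
  induction m generalizing ψ with
  | zero => exact ⟨fun _ => ψ, 0, rfl, by simp, by simp, hψ⟩
  | succ m ih =>
    obtain ⟨φ, hφ, hφ'⟩ := exists_dual_comp_eq α ((sourceIter α β U m).map β) ψ hψ
    obtain ⟨p, q, h0, h1, h2, h3⟩ := ih (φ ∘ₗ β) fun x hx => hφ' _ ⟨x, hx, rfl⟩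
    refine ⟨fun i => Nat.casesOn i ψ p, fun i => Nat.casesOn i φ q, rfl, ?_, ?_, h3⟩
    · rintro (_ | i) hi
      · exact hφ
      · exact h1 i (by omega)
    · rintro (_ | i) hi
      · intro x
        simp [h0]
      · exact h2 i (by omega)

theorem exists_seq_of_mem_targetIter (α β : V →ₗ[k] W) (Y : Submodule k W) (m : ℕ) {y : W}
    (hy : y ∈ targetIter α β Y m) :
    ∃ (x : ℕ → V) (z : ℕ → W), z 0 = y ∧ (∀ i < m, α (x i) = z i) ∧
      ∀ i < m, β (x i) = z (i + 1) := by
  induction m generalizing y with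
  | zero => exact ⟨0, fun _ => y, rfl, by simp, by simp⟩
  | succ m ih =>
    obtain ⟨x', hx', he⟩ := hy
    obtain ⟨x, z, h0, h1, h2⟩ := ih hx'
    refine ⟨fun i => Nat.casesOn i x' x, fun i => Nat.casesOn i y z, rfl, ?_, ?_⟩
    · rintro (_ | i) hi
      · exact he
      · exact h1 i (by omega)
    · rintro (_ | i) hi
      · exact h0.symm
      · exact h2 i (by omega)

/-- `φ ∘ α` vanishes on the `β`-preimage of the previous iterate, so it factors through `β` by a
functional that kills that iterate. -/
theorem exists_dual_seq_of_targetIter (α β : V →ₗ[k] W) (Y : Submodule k W) (m : ℕ)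
    (φ : Module.Dual k W) (hφ : ∀ y ∈ targetIter α β Y m, φ y = 0) :
    ∃ q : ℕ → Module.Dual k W, q 0 = φ ∧
      (∀ i < m, ∀ x, q i (α x) = q (i + 1) (β x)) ∧ ∀ y ∈ Y, q m y = 0 := by
  induction m generalizing φ with
  | zero => exact ⟨fun _ => φ, rfl, by simp, hφ⟩
  | succ m ih =>
    obtain ⟨φ', h1, h2⟩ := exists_dual_comp_eq β (targetIter α β Y m) (φ ∘ₗ α)
      fun x hx => hφ _ ⟨x, hx, rfl⟩
    obtain ⟨q, h0, hq, hm⟩ := ih φ' h2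
    refine ⟨fun i => Nat.casesOn i φ q, rfl, ?_, hm⟩
    rintro (_ | i) hi
    · intro x
      simp [h0, h1]
    · exact hq i (by omega)

/-- A sequence `x₀ ≠ 0, …, xₙ = 0` with `β x₀ = 0` and `α xᵢ = β xᵢ₊₁`, that is, a polynomial
solution of degree less than `n` of the pencil. -/
structure IsKernelChain (α β : V →ₗ[k] W) (n : ℕ) (x : ℕ → V) : Prop where
  map_zero : β (x 0) = 0
  map_succ : ∀ i < n, α (x i) = β (x (i + 1))
  last : x n = 0
  ne_zero : x 0 ≠ 0

/-- The iterates of `⊥` increase to some `U = α⁻¹(βU)`. Without a kernel chain `β` is injective on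
`U`, and `α` induces an injection `V ⧸ U → W ⧸ βU`; comparing dimensions gives `dim V ≤ dim W`. -/
theorem exists_isKernelChain_of_finrank_lt [FiniteDimensional k V] [FiniteDimensional k W]
    (α β : V →ₗ[k] W) (h : Module.finrank k W < Module.finrank k V) :
    ∃ n x, IsKernelChain α β n x := by
  by_contra! hno
  have hinj : ∀ m, sourceIter α β ⊥ m ⊓ LinearMap.ker β = ⊥ := by
    intro m
    rw [eq_bot_iff]
    rintro x ⟨hx, hxβ⟩
    by_contra hx0
    obtain ⟨z, rfl, hz, hm⟩ := exists_seq_of_mem_sourceIter α β ⊥ m hx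
    exact hno m z ⟨hxβ, hz, hm, hx0⟩
  have hmono : Monotone (sourceIter α β ⊥) := by
    refine monotone_nat_of_le_succ fun m => ?_
    induction m with
    | zero => exact bot_le
    | succ m ih => exact Submodule.comap_mono (Submodule.map_mono ih)
  obtain ⟨m, hm⟩ := monotone_stabilizes_iff_noetherian.2 inferInstance
    (⟨_, hmono⟩ : ℕ →o Submodule k V)
  replace hm : sourceIter α β ⊥ m = ((sourceIter α β ⊥ m).map β).comap α := hm (m + 1) (by omega)
  have hinj := hinj m
  generalize sourceIter α β ⊥ m = U at hm hinj
  have h1 : Module.finrank k (U.map β) = Module.finrank k U := by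
    rw [← LinearMap.range_domRestrict]
    exact LinearMap.finrank_range_of_inj (LinearMap.injective_domRestrict_iff.2 (disjoint_iff.2 hinj))
  have h2 : Function.Injective (U.mapQ (U.map β) α hm.le) := by
    rw [← LinearMap.ker_eq_bot, Submodule.ker_mapQ, ← hm, Submodule.mkQ_map_self]
  have h3 := LinearMap.finrank_le_finrank_of_injective h2
  have h4 := U.finrank_quotient_add_finrank
  have h5 := (U.map β).finrank_quotient_add_finrank
  omega

/-- Dual sequences to a kernel chain of minimal length. -/
theorem IsKernelChain.exists_dual {α β : V →ₗ[k] W} {m : ℕ} {x : ℕ → V}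
    (h : IsKernelChain α β (m + 1) x) (hmin : ∀ z, ¬ IsKernelChain α β m z) :
    ∃ (p : ℕ → Module.Dual k V) (q : ℕ → Module.Dual k W), p 0 (x 0) = 1 ∧
      (∀ i < m, ∀ v, q i (α v) = p i v) ∧ (∀ i < m, ∀ v, q i (β v) = p (i + 1) v) := by
  -- Otherwise a kernel chain of length `m` would start at `x 0`.
  have hx : x 0 ∉ sourceIter α β ⊥ m := by
    intro hx
    obtain ⟨z, h0, hz, hm⟩ := exists_seq_of_mem_sourceIter α β ⊥ m hx
    exact hmin z ⟨h0 ▸ h.map_zero, hz, hm, h0 ▸ h.ne_zero⟩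
  obtain ⟨ψ, h1, h2⟩ := exists_dual_eq_one hx
  obtain ⟨p, q, rfl, h3, h4, -⟩ := exists_dual_seq_of_sourceIter α β ⊥ m ψ h2
  exact ⟨p, q, h1, h3, h4⟩

/-- Sequences dual to a kernel chain, of minimal length, of the transposed maps. -/
theorem IsKernelChain.exists_predual {α β : V →ₗ[k] W} {m : ℕ} {q : ℕ → Module.Dual k W}
    (h : IsKernelChain α.dualMap β.dualMap (m + 1) q)
    (hmin : ∀ z, ¬ IsKernelChain α.dualMap β.dualMap m z) :
    ∃ (x : ℕ → V) (y : ℕ → W), q 0 (y 0) = 1 ∧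
      (∀ i < m, α (x i) = y i) ∧ (∀ i < m, β (x i) = y (i + 1)) := by
  -- If `q 0` killed this iterate, its dual sequence would be a kernel chain of length `m` of the
  -- transposed maps.
  have hq : ∃ y ∈ targetIter α β ⊤ m, q 0 y ≠ 0 := by
    by_contra! hq
    obtain ⟨z, h0, hz, hm⟩ := exists_dual_seq_of_targetIter α β ⊤ m (q 0) hq
    exact hmin z ⟨h0 ▸ h.map_zero, fun i hi => LinearMap.ext (hz i hi),
      LinearMap.ext fun y => hm y trivial, h0 ▸ h.ne_zero⟩
  obtain ⟨y, hy, hy0⟩ := hq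
  obtain ⟨x, z, h0, h1, h2⟩ := exists_seq_of_mem_targetIter α β ⊤ m
    (Submodule.smul_mem _ (q 0 y)⁻¹ hy)
  exact ⟨x, z, by simp [h0, hy0], h1, h2⟩

/-- A Jordan chain of maximal length for the eigenvalue `0` of the pencil, with dual sequences. -/
theorem exists_jordanChain [FiniteDimensional k V] (α β : V →ₗ[k] W)
    (hα : LinearMap.ker α ≠ ⊥)
    (hU : ∀ U : Submodule k V, U.map β ≤ U.map α → U ⊓ LinearMap.ker α = ⊥) :
    ∃ (m : ℕ) (x : ℕ → V) (p : ℕ → Module.Dual k V) (q : ℕ → Module.Dual k W),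
      α (x 0) = 0 ∧ (∀ i < m, β (x i) = α (x (i + 1))) ∧ p 0 (x 0) = 1 ∧
      (∀ i < m + 1, ∀ v, q i (β v) = p i v) ∧ (∀ i < m + 1, ∀ v, q i (α v) = p (i + 1) v) ∧
      p (m + 1) = 0 := by
  have hanti : Antitone (sourceIter β α ⊤) := by
    refine antitone_nat_of_succ_le fun m => ?_
    induction m with
    | zero => exact le_top
    | succ m ih => exact Submodule.comap_mono (Submodule.map_mono ih)
  -- The decreasing iterates stabilise at some `U` with `βU ≤ αU`, to which `hU` applies.
  have hex : ∃ m, sourceIter β α ⊤ m ⊓ LinearMap.ker α = ⊥ := by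
    obtain ⟨m, hm⟩ := monotone_stabilizes_iff_artinian.2 inferInstance
      (⟨fun m => OrderDual.toDual (sourceIter β α ⊤ m), fun _ _ h => hanti h⟩ :
        ℕ →o (Submodule k V)ᵒᵈ)
    have hm : sourceIter β α ⊤ m = ((sourceIter β α ⊤ m).map α).comap β := hm (m + 1) (by omega)
    exact ⟨m, hU _ (Submodule.map_le_iff_le_comap.2 hm.le)⟩
  classical
  obtain ⟨m, hm⟩ : ∃ m, Nat.find hex = m + 1 := by
    refine Nat.exists_eq_succ_of_ne_zero fun h0 => hα ?_
    have := Nat.find_spec hex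
    rw [h0] at this
    simpa [sourceIter] using this
  have h1 := Nat.find_spec hex
  -- Minimality of `m + 1`: a nonzero vector of `ker α` lies in the `m`-th iterate, which yields the
  -- chain, but not in the next one, which yields the dual sequence.
  have h2 := Nat.find_min hex (m := m) (by omega)
  rw [hm] at h1
  obtain ⟨x, hx, hx0⟩ := (Submodule.ne_bot_iff _).1 h2
  obtain ⟨z, rfl, hz, -⟩ := exists_seq_of_mem_sourceIter β α ⊤ m hx.1
  have hnot : z 0 ∉ sourceIter β α ⊤ (m + 1) := fun h => hx0 (by
    have : z 0 ∈ sourceIter β α ⊤ (m + 1) ⊓ LinearMap.ker α := ⟨h, hx.2⟩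
    rwa [h1] at this)
  obtain ⟨ψ, h3, h4⟩ := exists_dual_eq_one hnot
  obtain ⟨p, q, rfl, h5, h6, h7⟩ := exists_dual_seq_of_sourceIter β α ⊤ (m + 1) ψ h4
  exact ⟨m, z, p, q, hx.2, hz, h3, h5, h6, LinearMap.ext fun v => h7 v trivial⟩

end LinearRelations

/-- A unitriangular Toeplitz matrix is injective. -/
theorem mulVec_injective_of_toeplitz {k : Type u} [Field k] {n : ℕ} (a : ℕ → ℕ → k)
    (h0 : a 0 0 = 1) (hcol : ∀ i, i + 1 < n → a (i + 1) 0 = 0)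
    (hdiag : ∀ i j, i + 1 < n → j + 1 < n → a (i + 1) (j + 1) = a i j) :
    Function.Injective (Matrix.of fun i j : Fin n => a i j).mulVec := by
  have hlow : ∀ j i, i < n → j < i → a i j = 0 := by
    intro j
    induction j with
    | zero =>
      rintro (_ | i) hi hj
      · omega
      · exact hcol i hi
    | succ j ih =>
      rintro (_ | i) hi hj
      · omega
      · rw [hdiag i j hi (by omega)]
        exact ih i (by omega) (by omega)
  have hone : ∀ i < n, a i i = 1 := by
    intro i
    induction i with
    | zero => exact fun _ => h0
    | succ i ih => exact fun hi => (hdiag i i hi hi).trans (ih (by omega))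
  rw [Matrix.mulVec_injective_iff_isUnit, Matrix.isUnit_iff_isUnit_det,
    Matrix.det_of_isUpperTriangular]
  · simp [hone]
  · intro i j hij
    exact hlow _ _ i.2 hij

/-! ### Splitting off a listed module. -/

section Retracts

variable {k : Type u} [Field k] {M : KroneckerRep.{u, v} k}

theorem linearCombination_comp_mulVecLin {V : Type v} {W : Type w} [AddCommGroup V]
    [AddCommGroup W] [Module k V] [Module k W] {d₁ d₂ : ℕ} (A : Matrix (Fin d₂) (Fin d₁) k)
    (f : V →ₗ[k] W) (x : Fin d₁ → V) (y : Fin d₂ → W) (h : ∀ j, f (x j) = ∑ i, A i j • y i) :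
    Fintype.linearCombination k y ∘ₗ A.mulVecLin = f ∘ₗ Fintype.linearCombination k x := by
  refine LinearMap.pi_ext' fun j => LinearMap.ext_ring ?_
  simp [Fintype.linearCombination_apply, h]

theorem pi_comp_eq_mulVecLin_comp {V : Type v} {W : Type w} [AddCommGroup V]
    [AddCommGroup W] [Module k V] [Module k W] {d₁ d₂ : ℕ} (A : Matrix (Fin d₂) (Fin d₁) k)
    (f : V →ₗ[k] W) (p : Fin d₁ → Module.Dual k V) (q : Fin d₂ → Module.Dual k W)
    (h : ∀ i v, q i (f v) = ∑ j, A i j • p j v) :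
    LinearMap.pi q ∘ₗ f = A.mulVecLin ∘ₗ LinearMap.pi p := by
  ext v i
  simp [h, Matrix.mulVec, dotProduct]

/-- The morphism from `(A, B)` given by the images of the standard basis vectors. -/
def homOfVectors {d₁ d₂ : ℕ} (A B : Matrix (Fin d₂) (Fin d₁) k) (x : Fin d₁ → M.V₁)
    (y : Fin d₂ → M.V₂) (hα : ∀ j, M.α (x j) = ∑ i, A i j • y i)
    (hβ : ∀ j, M.β (x j) = ∑ i, B i j • y i) : Hom (ofMatrices A B) M :=
  ⟨(Fintype.linearCombination k x, Fintype.linearCombination k y),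
    linearCombination_comp_mulVecLin A M.α x y hα, linearCombination_comp_mulVecLin B M.β x y hβ⟩

/-- The morphism to `(A, B)` given by its coordinate functionals. -/
def homOfDuals {d₁ d₂ : ℕ} (A B : Matrix (Fin d₂) (Fin d₁) k)
    (p : Fin d₁ → Module.Dual k M.V₁) (q : Fin d₂ → Module.Dual k M.V₂)
    (hα : ∀ i v, q i (M.α v) = ∑ j, A i j • p j v)
    (hβ : ∀ i v, q i (M.β v) = ∑ j, B i j • p j v) : Hom M (ofMatrices A B) :=
  ⟨(LinearMap.pi p, LinearMap.pi q),
    pi_comp_eq_mulVecLin_comp A M.α p q hα, pi_comp_eq_mulVecLin_comp B M.β p q hβ⟩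

theorem pi_comp_linearCombination_injective {V : Type w} [AddCommGroup V] [Module k V] {d : ℕ}
    (x : Fin d → V) (p : Fin d → Module.Dual k V)
    (h : Function.Injective (Matrix.of fun i j => p i (x j)).mulVec) :
    Function.Injective (LinearMap.pi p ∘ₗ Fintype.linearCombination k x) := by
  convert h using 1
  ext c i
  simp [Fintype.linearCombination_apply, Matrix.mulVec, dotProduct, mul_comm]

theorem sum_ite_smul_eq {V : Type w} [AddCommGroup V] [Module k V] {ι : Type*} [Fintype ι]
    (P : ι → Prop) [DecidablePred P] (y : ι → V) (i₀ : ι) (h : ∀ i, P i ↔ i = i₀) :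
    ∑ i, (if P i then (1 : k) else 0) • y i = y i₀ := by
  classical
  simp [h]

theorem sum_ite_smul_eq_zero {V : Type w} [AddCommGroup V] [Module k V] {ι : Type*} [Fintype ι]
    (P : ι → Prop) [DecidablePred P] (y : ι → V) (h : ∀ i, ¬ P i) :
    ∑ i, (if P i then (1 : k) else 0) • y i = 0 := by
  simp [h]

/-- `L` embeds into `M` by a morphism that some morphism `M → L` splits up to an automorphism. -/
def IsRetract (L : KroneckerRep.{u, w} k) (M : KroneckerRep.{u, v} k) : Prop :=
  ∃ (s : Hom L M) (r : Hom M L), Function.Injective (r.1.1 ∘ₗ s.1.1) ∧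
    Function.Injective (r.1.2 ∘ₗ s.1.2)

/-- Vectors define the morphism into `M`, functionals the one out of `M`; the composites are the two
pairing matrices. -/
theorem isRetract_ofMatrices {d₁ d₂ : ℕ} (A B : Matrix (Fin d₂) (Fin d₁) k)
    (x : Fin d₁ → M.V₁) (y : Fin d₂ → M.V₂) (p : Fin d₁ → Module.Dual k M.V₁)
    (q : Fin d₂ → Module.Dual k M.V₂)
    (hα : ∀ j, M.α (x j) = ∑ i, A i j • y i) (hβ : ∀ j, M.β (x j) = ∑ i, B i j • y i)
    (hα' : ∀ i v, q i (M.α v) = ∑ j, A i j • p j v)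
    (hβ' : ∀ i v, q i (M.β v) = ∑ j, B i j • p j v)
    (h₁ : Function.Injective (Matrix.of fun i j => p i (x j)).mulVec)
    (h₂ : Function.Injective (Matrix.of fun i j => q i (y j)).mulVec) :
    IsRetract (ofMatrices A B) M :=
  ⟨homOfVectors A B x y hα hβ, homOfDuals A B p q hα' hβ',
    pi_comp_linearCombination_injective x p h₁, pi_comp_linearCombination_injective y q h₂⟩

/-- The chain spans a copy of `I_{m+1}`, since `β x₀ = 0` and `α xₘ = β xₘ₊₁ = 0`. From
`p_{i+1}(x_{j+1}) = q_i(β x_{j+1}) = q_i(α x_j) = p_i(x_j)` and `p_{i+1}(x₀) = q_i(β x₀) = 0` the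
pairing is unitriangular Toeplitz. -/
theorem isRetract_preinj {m : ℕ} {x : ℕ → M.V₁} (h : IsKernelChain M.α M.β (m + 1) x)
    (hmin : ∀ z, ¬ IsKernelChain M.α M.β m z) : IsRetract (preinj k (m + 1)) M := by
  obtain ⟨p, q, h0, hα, hβ⟩ := h.exists_dual hmin
  have hx0 := h.map_zero
  have hx := h.map_succ
  have hcol : ∀ i, i + 1 < m + 1 → p (i + 1) (x 0) = 0 := fun i hi => by
    rw [← hβ i (by omega), hx0, map_zero]
  have hdiag : ∀ i j, i + 1 < m + 1 → j + 1 < m + 1 → p (i + 1) (x (j + 1)) = p i (x j) :=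
    fun i j hi hj => by
      rw [← hβ i (by omega), ← hx j (by omega), hα i (by omega)]
  have hlast : M.α (x m) = 0 := by rw [hx m (by omega), h.last, map_zero]
  refine isRetract_ofMatrices (M := M) (d₁ := m + 1) (d₂ := m) _ _ (fun i => x i)
    (fun i => M.α (x i)) (fun i => p i) (fun i => q i) ?_ ?_ ?_ ?_ ?_ ?_
  · intro j
    rcases Nat.lt_or_ge j m with hj | hj
    · exact (sum_ite_smul_eq (fun i : Fin m => (j : ℕ) = i) (fun i : Fin m => M.α (x i)) ⟨j, hj⟩
        (fun i => by rw [Fin.ext_iff]; exact eq_comm)).symm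
    · have hjm : (j : ℕ) = m := by omega
      refine Eq.trans (by rw [hjm, hlast]) (sum_ite_smul_eq_zero (fun i : Fin m => (j : ℕ) = i)
        (fun i : Fin m => M.α (x i)) (fun i => by omega)).symm
  · rintro ⟨_ | j, hj⟩
    · exact hx0.trans (sum_ite_smul_eq_zero (fun i : Fin m => 0 = (i : ℕ) + 1)
        (fun i : Fin m => M.α (x i)) (fun i => by omega)).symm
    · exact (hx j (by omega)).symm.trans (sum_ite_smul_eq (fun i : Fin m => j + 1 = (i : ℕ) + 1)
        (fun i : Fin m => M.α (x i)) ⟨j, by omega⟩ (fun i => by simp [Fin.ext_iff, eq_comm])).symm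
  · intro i v
    exact (hα i i.2 v).trans (sum_ite_smul_eq (fun j : Fin (m + 1) => (j : ℕ) = i)
      (fun j : Fin (m + 1) => p j v) i.castSucc (fun i => by simp [Fin.ext_iff])).symm
  · intro i v
    exact (hβ i i.2 v).trans (sum_ite_smul_eq (fun j : Fin (m + 1) => (j : ℕ) = i + 1)
      (fun j : Fin (m + 1) => p j v) i.succ (fun i => by simp [Fin.ext_iff])).symm
  · exact mulVec_injective_of_toeplitz (fun i j => p i (x j)) h0 hcol hdiag
  · have : (Matrix.of fun i j : Fin m => q i (M.α (x j))) =
        Matrix.of fun i j : Fin m => p i (x j) := by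
      ext i j
      exact hα i i.2 _
    rw [this]
    exact mulVec_injective_of_toeplitz (fun i j => p i (x j)) h0 (fun i hi => hcol i (by omega))
      fun i j hi hj => hdiag i j (by omega) (by omega)

/-- Transposed to `isRetract_preinj`: the chain now provides the functionals, and its minimality the
vectors. -/
theorem isRetract_preproj {m : ℕ} {q : ℕ → Module.Dual k M.V₂}
    (h : IsKernelChain M.α.dualMap M.β.dualMap (m + 1) q)
    (hmin : ∀ z, ¬ IsKernelChain M.α.dualMap M.β.dualMap m z) :
    IsRetract (preproj k (m + 1)) M := by
  obtain ⟨x, y, h0, hα, hβ⟩ := h.exists_predual hmin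
  have hq0 : ∀ v, q 0 (M.β v) = 0 := fun v => LinearMap.congr_fun h.map_zero v
  have hq : ∀ i < m + 1, ∀ v, q i (M.α v) = q (i + 1) (M.β v) :=
    fun i hi v => LinearMap.congr_fun (h.map_succ i hi) v
  have hlast : ∀ v, q m (M.α v) = 0 := fun v => by
    rw [hq m (by omega), h.last, LinearMap.zero_apply]
  have hrow : ∀ j, j + 1 < m + 1 → q 0 (y (j + 1)) = 0 := fun j hj => by
    rw [← hβ j (by omega), hq0]
  have hdiag : ∀ i j, i + 1 < m + 1 → j + 1 < m + 1 → q (j + 1) (y (i + 1)) = q j (y i) :=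
    fun i j hi hj => by
      rw [← hβ i (by omega), ← hα i (by omega), hq j (by omega)]
  -- The pairing is lower triangular here, so the Toeplitz lemma is applied to its transpose; sizes
  -- `m` and `m + 1` are needed at the two vertices.
  have hinj : ∀ n ≤ m + 1, Function.Injective (Matrix.of fun i j : Fin n => q i (y j)).mulVec := by
    intro n hn
    have := mulVec_injective_of_toeplitz (n := n) (fun i j => q j (y i)) h0
      (fun i hi => hrow i (by omega)) fun i j hi hj => hdiag i j (by omega) (by omega)
    rw [Matrix.mulVec_injective_iff_isUnit] at this ⊢
    exact (Matrix.isUnit_transpose _).2 this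
  refine isRetract_ofMatrices (M := M) (d₁ := m) (d₂ := m + 1) _ _ (fun i => x i)
    (fun i => y i) (fun i => q i ∘ₗ M.α) (fun i => q i) ?_ ?_ ?_ ?_ ?_ ?_
  · intro j
    exact (hα j j.2).trans (sum_ite_smul_eq (fun i : Fin (m + 1) => (i : ℕ) = j)
      (fun i : Fin (m + 1) => y i) j.castSucc (fun i => by simp [Fin.ext_iff])).symm
  · intro j
    exact (hβ j j.2).trans (sum_ite_smul_eq (fun i : Fin (m + 1) => (i : ℕ) = j + 1)
      (fun i : Fin (m + 1) => y i) j.succ (fun i => by simp [Fin.ext_iff])).symm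
  · intro i v
    rcases Nat.lt_or_ge i m with hi | hi
    · exact (sum_ite_smul_eq (fun j : Fin m => (i : ℕ) = j) (fun j : Fin m => q j (M.α v)) ⟨i, hi⟩
        (fun j => by rw [Fin.ext_iff]; exact eq_comm)).symm
    · have him : (i : ℕ) = m := by omega
      exact Eq.trans (by rw [him, hlast]) (sum_ite_smul_eq_zero (fun j : Fin m => (i : ℕ) = j)
        (fun j : Fin m => q j (M.α v)) (fun j => by omega)).symm
  · rintro ⟨_ | i, hi⟩ v
    · exact (hq0 v).trans (sum_ite_smul_eq_zero (fun j : Fin m => 0 = (j : ℕ) + 1)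
        (fun j : Fin m => q j (M.α v)) (fun j => by omega)).symm
    · exact (hq i (by omega) v).symm.trans
        (sum_ite_smul_eq (fun j : Fin m => i + 1 = (j : ℕ) + 1)
        (fun j : Fin m => q j (M.α v)) ⟨i, by omega⟩ (fun j => by simp [Fin.ext_iff, eq_comm])).symm
  · have : (Matrix.of fun i j : Fin m => (q i ∘ₗ M.α) (x j)) =
        Matrix.of fun i j : Fin m => q i (y j) := by
      ext i j
      exact congrArg (q i) (hα j j.2)
    rw [this]
    exact hinj m (by omega)
  · exact hinj _ le_rfl

theorem jordanCell_sum_smul_vec {V : Type w} [AddCommGroup V] [Module k V] {m : ℕ} (c : k)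
    (y : ℕ → V) (j : Fin (m + 1)) (z : V) (h0 : (j : ℕ) = 0 → z = c • y 0)
    (hs : ∀ i, (j : ℕ) = i + 1 → z = c • y (i + 1) + y i) :
    z = ∑ i : Fin (m + 1), jordanCell (m + 1) c i j • y i := by
  have hsplit : ∀ i : Fin (m + 1), jordanCell (m + 1) c i j • y i =
      c • ((if i = j then (1 : k) else 0) • y i) +
        (if (j : ℕ) = i + 1 then (1 : k) else 0) • y i := by
    intro i
    by_cases hij : i = j
    · simp [jordanCell, hij]
    · simp [jordanCell, hij]
  rw [Finset.sum_congr rfl fun i _ => hsplit i, Finset.sum_add_distrib, ← Finset.smul_sum,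
    sum_ite_smul_eq (fun i => i = j) _ j (fun _ => Iff.rfl)]
  obtain ⟨_ | j, hj⟩ := j
  · rw [sum_ite_smul_eq_zero _ _ (fun i => by simp), add_zero]
    exact h0 rfl
  · rw [sum_ite_smul_eq _ _ ⟨j, by omega⟩ (fun i => by rw [Fin.ext_iff]; simp [eq_comm])]
    exact hs j rfl

theorem jordanCell_sum_smul_dual {V : Type w} [AddCommGroup V] [Module k V] {m : ℕ} (c : k)
    (y : ℕ → V) (i : Fin (m + 1)) (z : V) (hlast : y (m + 1) = 0)
    (hz : z = c • y i + y (i + 1)) :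
    z = ∑ j : Fin (m + 1), jordanCell (m + 1) c i j • y j := by
  have hsplit : ∀ j : Fin (m + 1), jordanCell (m + 1) c i j • y j =
      c • ((if i = j then (1 : k) else 0) • y j) +
        (if (j : ℕ) = i + 1 then (1 : k) else 0) • y j := by
    intro j
    by_cases hij : i = j
    · simp [jordanCell, hij]
    · simp [jordanCell, hij]
  rw [Finset.sum_congr rfl fun i _ => hsplit i, Finset.sum_add_distrib, ← Finset.smul_sum,
    sum_ite_smul_eq (fun j => i = j) _ i (fun _ => eq_comm), hz]
  congr 1
  rcases Nat.lt_or_ge i m with hi | hi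
  · rw [sum_ite_smul_eq _ _ ⟨i + 1, by omega⟩ (fun i => by rw [Fin.ext_iff])]
  · rw [sum_ite_smul_eq_zero _ _ (fun j => by omega), show (i : ℕ) + 1 = m + 1 by omega, hlast]

theorem sum_one_smul_dual {V : Type w} [AddCommGroup V] [Module k V] {m : ℕ} (y : ℕ → V)
    (i : Fin m) : y i = ∑ j : Fin m, (1 : Matrix (Fin m) (Fin m) k) i j • y j := by
  simp [Matrix.one_apply]

theorem sum_one_smul_vec {V : Type w} [AddCommGroup V] [Module k V] {m : ℕ} (y : ℕ → V)
    (j : Fin m) : y j = ∑ i : Fin m, (1 : Matrix (Fin m) (Fin m) k) i j • y i := by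
  simp [Matrix.one_apply]

/-- On the bases `x i` and `β (x i)` of the chain, `β` is the identity and `α` the nilpotent Jordan
cell. -/
theorem exists_isRetract_regularInfty (hα : LinearMap.ker M.α ≠ ⊥)
    (hU : ∀ U : Submodule k M.V₁, U.map M.β ≤ U.map M.α → U ⊓ LinearMap.ker M.α = ⊥) :
    ∃ m : ℕ, IsRetract (regularInfty k (m + 1)) M := by
  obtain ⟨m, x, p, q, hx0, hx, h0, hβ, hα, hlast⟩ := exists_jordanChain M.α M.β hα hU
  refine ⟨m, ?_⟩
  have hinj : Function.Injective (Matrix.of fun i j : Fin (m + 1) => p i (x j)).mulVec := by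
    refine mulVec_injective_of_toeplitz (fun i j => p i (x j)) h0 (fun i hi => ?_)
      fun i j hi hj => ?_
    · rw [← hα i (by omega), hx0, map_zero]
    · rw [← hα i (by omega), ← hx j (by omega), hβ i (by omega)]
  refine isRetract_ofMatrices (M := M) _ _ (fun i => x i)
    (fun i => M.β (x i)) (fun i => p i) (fun i => q i) ?_ ?_ ?_ ?_ hinj ?_
  · intro j
    refine jordanCell_sum_smul_vec 0 (fun i => M.β (x i)) j _ (fun hj => ?_) fun i hi => ?_
    · simp [hj, hx0]
    · simp [hi, hx i (by omega)]
  · exact fun j => sum_one_smul_vec (fun i => M.β (x i)) j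
  · intro i v
    refine jordanCell_sum_smul_dual 0 (fun j => p j v) i _ (by simp [hlast]) ?_
    simp [hα i i.2]
  · exact fun i v => (hβ i i.2 v).trans (sum_one_smul_dual (fun j => p j v) i)
  · have : (Matrix.of fun i j : Fin (m + 1) => q i (M.β (x j))) =
        Matrix.of fun i j : Fin (m + 1) => p i (x j) := by
      ext i j
      exact hβ i i.2 _
    rwa [this]

theorem exists_isRetract_regular (c : k) (hα : Function.Injective M.α)
    (hc : LinearMap.ker (M.β - c • M.α) ≠ ⊥) : ∃ m : ℕ, IsRetract (regular (m + 1) c) M := by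
  -- As `α` is injective, `dim U = dim αU ≤ dim (β - cα)U`, so `β - cα` is injective on `U`.
  have hU : ∀ U : Submodule k M.V₁, U.map M.α ≤ U.map (M.β - c • M.α) →
      U ⊓ LinearMap.ker (M.β - c • M.α) = ⊥ := by
    intro U hU
    rw [← disjoint_iff, ← LinearMap.injective_domRestrict_iff, ← LinearMap.ker_eq_bot,
      ← Submodule.finrank_eq_zero]
    have h1 := (M.β - c • M.α).domRestrict U |>.finrank_range_add_finrank_ker
    have h2 := (Submodule.equivMapOfInjective M.α hα U).finrank_eq
    have h3 := Submodule.finrank_mono hU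
    rw [LinearMap.range_domRestrict] at h1
    omega
  obtain ⟨m, x, p, q, hx0, hx, h0, hβ, hα, hlast⟩ := exists_jordanChain _ M.α hc hU
  replace hβ' : ∀ i < m + 1, ∀ v, q i (M.β v) = c • p i v + p (i + 1) v := by
    intro i hi v
    rw [← hα i hi, ← hβ i hi]
    simp
  refine ⟨m, ?_⟩
  have hinj : Function.Injective (Matrix.of fun i j : Fin (m + 1) => p i (x j)).mulVec := by
    refine mulVec_injective_of_toeplitz (fun i j => p i (x j)) h0 (fun i hi => ?_)
      fun i j hi hj => ?_
    · rw [← hα i (by omega), hx0, map_zero]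
    · rw [← hα i (by omega), ← hx j (by omega), hβ i (by omega)]
  refine isRetract_ofMatrices (M := M) _ _ (fun i => x i)
    (fun i => M.α (x i)) (fun i => p i) (fun i => q i) ?_ ?_ ?_ ?_ hinj ?_
  · exact fun j => sum_one_smul_vec (fun i => M.α (x i)) j
  · intro j
    refine jordanCell_sum_smul_vec c (fun i => M.α (x i)) j _ (fun hj => ?_) fun i hi => ?_
    · rw [hj]
      simpa [sub_eq_zero] using hx0
    · rw [hi]
      have := hx i (by omega)
      simp only [LinearMap.sub_apply, LinearMap.smul_apply] at this
      rw [this]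
      abel
  · exact fun i v => (hβ i i.2 v).trans (sum_one_smul_dual (fun j => p j v) i)
  · intro i v
    exact jordanCell_sum_smul_dual c (fun j => p j v) i _ (by simp [hlast]) (hβ' i i.2 v)
  · have : (Matrix.of fun i j : Fin (m + 1) => q i (M.α (x j))) =
        Matrix.of fun i j : Fin (m + 1) => p i (x j) := by
      ext i j
      exact hβ i i.2 _
    rwa [this]

theorem exists_isRetract_preinj (h : ∃ n x, IsKernelChain M.α M.β n x) :
    ∃ m : ℕ, IsRetract (preinj k (m + 1)) M := by
  classical
  obtain ⟨x, hx⟩ := Nat.find_spec h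
  -- Length `0` is impossible: `x 0` would be both zero and nonzero.
  obtain ⟨m, hm : Nat.find h = m + 1⟩ := Nat.exists_eq_succ_of_ne_zero (n := Nat.find h) fun h0 =>
    hx.ne_zero (h0 ▸ hx.last)
  rw [hm] at hx
  refine ⟨m, isRetract_preinj (x := x) hx fun z hz => ?_⟩
  exact Nat.find_min h (m := m) (by omega) ⟨z, hz⟩

theorem exists_isRetract_preproj (h : ∃ n q, IsKernelChain M.α.dualMap M.β.dualMap n q) :
    ∃ m : ℕ, IsRetract (preproj k (m + 1)) M := by
  classical
  obtain ⟨x, hx⟩ := Nat.find_spec h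
  obtain ⟨m, hm : Nat.find h = m + 1⟩ := Nat.exists_eq_succ_of_ne_zero (n := Nat.find h) fun h0 =>
    hx.ne_zero (h0 ▸ hx.last)
  rw [hm] at hx
  refine ⟨m, isRetract_preproj (q := x) hx fun z hz => ?_⟩
  exact Nat.find_min h (m := m) (by omega) ⟨z, hz⟩

/-- If `U` met `ker α`, the restricted pencil `U ⇉ αU` would have a target of smaller dimension than
its source, hence a kernel chain. -/
theorem inf_ker_eq_bot_of_no_isKernelChain (hno : ∀ n x, ¬ IsKernelChain M.α M.β n x)
    (U : Submodule k M.V₁) (hU : U.map M.β ≤ U.map M.α) : U ⊓ LinearMap.ker M.α = ⊥ := by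
  by_contra hne
  let α' : U →ₗ[k] U.map M.α := M.α.restrict fun x hx => ⟨x, hx, rfl⟩
  let β' : U →ₗ[k] U.map M.α := M.β.restrict fun x hx => hU ⟨x, hx, rfl⟩
  have hlt : Module.finrank k (U.map M.α) < Module.finrank k U := by
    have h1 := (M.α.domRestrict U).finrank_range_add_finrank_ker
    rw [LinearMap.range_domRestrict] at h1
    have h2 : Module.finrank k (LinearMap.ker (M.α.domRestrict U)) ≠ 0 := by
      rwa [Ne, Submodule.finrank_eq_zero, LinearMap.ker_eq_bot,
        LinearMap.injective_domRestrict_iff, disjoint_iff]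
    omega
  obtain ⟨n, x, hx⟩ := exists_isKernelChain_of_finrank_lt α' β' hlt
  exact hno n (fun i => x i) ⟨congrArg Subtype.val hx.map_zero,
    fun i hi => congrArg Subtype.val (hx.map_succ i hi), congrArg Subtype.val hx.last,
    fun h => hx.ne_zero (Subtype.ext h)⟩

/-- Every nonzero module has a retract among the listed modules. -/
theorem exists_isRetract_label [IsAlgClosed k] (M : KroneckerRep.{u, v} k)
    (hM : 0 < Module.finrank k M.V₁ + Module.finrank k M.V₂) :
    ∃ ℓ : Label k, IsRetract ℓ.rep M := by
  by_cases hI : ∃ n x, IsKernelChain M.α M.β n x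
  · obtain ⟨m, h⟩ := exists_isRetract_preinj hI
    exact ⟨.I m.succPNat, h⟩
  by_cases hP : ∃ n q, IsKernelChain M.α.dualMap M.β.dualMap n q
  · obtain ⟨m, h⟩ := exists_isRetract_preproj hP
    exact ⟨.P m.succPNat, h⟩
  have h1 : Module.finrank k M.V₁ ≤ Module.finrank k M.V₂ :=
    not_lt.1 fun h => hI (exists_isKernelChain_of_finrank_lt _ _ h)
  have h2 : Module.finrank k M.V₂ ≤ Module.finrank k M.V₁ := by
    refine not_lt.1 fun h => hP (exists_isKernelChain_of_finrank_lt _ _ ?_)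
    simpa only [Subspace.dual_finrank_eq] using h
  push Not at hI
  by_cases hα : LinearMap.ker M.α = ⊥
  · have hinj := LinearMap.ker_eq_bot.1 hα
    let e := LinearEquiv.ofInjectiveOfFinrankEq M.α hinj (le_antisymm h1 h2)
    have : Nontrivial M.V₁ := Module.nontrivial_of_finrank_pos (R := k) (by omega)
    -- An eigenvector of `α⁻¹β` with eigenvalue `c` lies in `ker (β - cα)`.
    obtain ⟨c, hc⟩ := Module.End.exists_eigenvalue (e.symm.toLinearMap ∘ₗ M.β)
    obtain ⟨x, hx⟩ := hc.exists_hasEigenvector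
    obtain ⟨m, h⟩ := exists_isRetract_regular c hinj <| (Submodule.ne_bot_iff _).2 ⟨x, by
      have := congrArg e hx.apply_eq_smul
      rw [map_smul] at this
      simp only [LinearMap.comp_apply, LinearEquiv.coe_coe, LinearEquiv.apply_symm_apply] at this
      rw [LinearMap.mem_ker, LinearMap.sub_apply, this]
      exact sub_self _, hx.2⟩
    exact ⟨.R m.succPNat c, h⟩
  · obtain ⟨m, h⟩ := exists_isRetract_regularInfty hα (inf_ker_eq_bot_of_no_isKernelChain hI)
    exact ⟨.Rinfty m.succPNat, h⟩

end Retracts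

/-! ### Existence of decompositions, by induction on dimension. -/

section Existence

variable {k : Type u} [Field k] {M : KroneckerRep.{u, v} k}

theorem Label.finrank_pos (ℓ : Label k) :
    0 < Module.finrank k ℓ.rep.V₁ + Module.finrank k ℓ.rep.V₂ := by
  cases ℓ with
  | P n =>
    change 0 < Module.finrank k (Fin _ → k) + Module.finrank k (Fin n → k)
    simp
  | I n =>
    change 0 < Module.finrank k (Fin n → k) + Module.finrank k (Fin _ → k)
    simp
  | R n c =>
    change 0 < Module.finrank k (Fin n → k) + Module.finrank k (Fin n → k)
    simp
  | Rinfty n =>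
    change 0 < Module.finrank k (Fin n → k) + Module.finrank k (Fin n → k)
    simp

/-- The map `(l, x) ↦ s l + g x` from `L × K` to `V`, where `g : K ≃ ker r`, is bijective when
`r ∘ s` is injective. -/
theorem bijective_add_of_comp_injective {L V K : Type*} [AddCommGroup L] [Module k L]
    [FiniteDimensional k L] [AddCommGroup V] [Module k V] [AddCommGroup K] [Module k K]
    (s : L →ₗ[k] V) (r : V →ₗ[k] L) (h : Function.Injective (r ∘ₗ s))
    (g : K ≃ₗ[k] LinearMap.ker r) :
    Function.Bijective (s.coprod ((LinearMap.ker r).subtype ∘ₗ g.toLinearMap)) := by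
  have hr : ∀ y : LinearMap.ker r, r y = 0 := fun y => y.2
  constructor
  · rw [injective_iff_map_eq_zero]
    rintro ⟨l, x⟩ hlx
    simp only [LinearMap.coprod_apply, LinearMap.comp_apply, Submodule.subtype_apply,
      LinearEquiv.coe_coe] at hlx
    have hl : l = 0 := by
      apply h
      have := congrArg r hlx
      rw [map_add, hr, add_zero] at this
      simpa using this
    subst hl
    simpa using hlx
  · intro v
    obtain ⟨l, hl⟩ := (LinearMap.injective_iff_surjective.1 h) (r v)
    have hv : v - s l ∈ LinearMap.ker r := by
      rw [LinearMap.mem_ker, map_sub, sub_eq_zero]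
      exact hl.symm
    exact ⟨(l, g.symm ⟨_, hv⟩), by simp⟩

/-- The product over `Fin (n + 1)` as a binary product. -/
def piFinSuccEquiv {n : ℕ} (V : Fin (n + 1) → Type w) [∀ j, AddCommGroup (V j)]
    [∀ j, Module k (V j)] : (∀ j, V j) ≃ₗ[k] V 0 × ∀ j : Fin n, V j.succ :=
  { (Fin.consEquiv V).symm with
    map_add' := fun _ _ => rfl
    map_smul' := fun _ _ => rfl }

/-- `M = s(L) ⊕ ker r`, so `ℓ` is prepended to the decomposition of `ker r`. -/
theorem Decomposition.nonempty_of_retract (ℓ : Label k) (s : Hom ℓ.rep M) (r : Hom M ℓ.rep)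
    (h₁ : Function.Injective (r.1.1 ∘ₗ s.1.1)) (h₂ : Function.Injective (r.1.2 ∘ₗ s.1.2))
    (D : Decomposition (ker r).toRep) : Nonempty (Decomposition M) := by
  let lab : Fin (D.r + 1) → Label k := Fin.cons ℓ D.label
  have b₁ := bijective_add_of_comp_injective s.1.1 r.1.1 h₁ D.F.e₁
  have b₂ := bijective_add_of_comp_injective s.1.2 r.1.2 h₂ D.F.e₂
  refine ⟨⟨D.r + 1, lab,
    ⟨(piFinSuccEquiv fun j => (lab j).rep.V₁).trans (LinearEquiv.ofBijective _ b₁),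
      (piFinSuccEquiv fun j => (lab j).rep.V₂).trans (LinearEquiv.ofBijective _ b₂), ?_, ?_⟩⟩⟩
  · intro x
    have h1 : s.1.2 (ℓ.rep.α (x 0)) = M.α (s.1.1 (x 0)) := LinearMap.congr_fun s.2.1 (x 0)
    have h2 := congrArg Subtype.val (D.F.comm_α fun j => x j.succ)
    exact (congrArg₂ (· + ·) h1 h2).trans (map_add M.α _ _).symm
  · intro x
    have h1 : s.1.2 (ℓ.rep.β (x 0)) = M.β (s.1.1 (x 0)) := LinearMap.congr_fun s.2.2 (x 0)
    have h2 := congrArg Subtype.val (D.F.comm_β fun j => x j.succ)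
    exact (congrArg₂ (· + ·) h1 h2).trans (map_add M.β _ _).symm

theorem nonempty_decomposition [IsAlgClosed k] (M : KroneckerRep.{u, v} k) :
    Nonempty (Decomposition M) := by
  induction hd : Module.finrank k M.V₁ + Module.finrank k M.V₂ using Nat.strong_induction_on
    generalizing M with
  | _ d ih =>
    rcases Nat.eq_zero_or_pos d with h0 | hpos
    · have h₁ : Subsingleton M.V₁ := Module.finrank_zero_iff.1 (by omega : Module.finrank k M.V₁ = 0)
      have h₂ : Subsingleton M.V₂ := Module.finrank_zero_iff.1 (by omega : Module.finrank k M.V₂ = 0)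
      refine ⟨⟨0, Fin.elim0, ⟨?_, ?_, fun _ => Subsingleton.elim _ _,
        fun _ => Subsingleton.elim _ _⟩⟩⟩
      · have : Subsingleton (directSum fun j => (Fin.elim0 j : Label k).rep).V₁ :=
          inferInstanceAs (Subsingleton (∀ j : Fin 0, _))
        exact LinearEquiv.ofSubsingleton _ _
      · have : Subsingleton (directSum fun j => (Fin.elim0 j : Label k).rep).V₂ :=
          inferInstanceAs (Subsingleton (∀ j : Fin 0, _))
        exact LinearEquiv.ofSubsingleton _ _
    · obtain ⟨ℓ, s, r, h₁, h₂⟩ := exists_isRetract_label M (hd ▸ hpos)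
      -- `r` is surjective because `r ∘ s` is, so its kernel is smaller by the positive dimension of
      -- `ℓ.rep`.
      have hlt : Module.finrank k (ker r).toRep.V₁ + Module.finrank k (ker r).toRep.V₂ < d := by
        have e₁ := r.1.1.finrank_range_add_finrank_ker
        have e₂ := r.1.2.finrank_range_add_finrank_ker
        have s₁ : Function.Surjective r.1.1 :=
          Function.Surjective.of_comp (g := s.1.1) (LinearMap.injective_iff_surjective.1 h₁)
        have s₂ : Function.Surjective r.1.2 :=
          Function.Surjective.of_comp (g := s.1.2) (LinearMap.injective_iff_surjective.1 h₂)
        rw [LinearMap.range_eq_top.2 s₁, finrank_top] at e₁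
        rw [LinearMap.range_eq_top.2 s₂, finrank_top] at e₂
        have := ℓ.finrank_pos
        change Module.finrank k (LinearMap.ker r.1.1) + Module.finrank k (LinearMap.ker r.1.2) < d
        omega
      obtain ⟨D⟩ := ih _ hlt (ker r).toRep rfl
      exact Decomposition.nonempty_of_retract ℓ s r h₁ h₂ D

end Existence

/-! ### Morphisms from the listed modules to `P_d`. -/

section HomToPreprojective

variable {k : Type u} [Field k]

theorem preproj_α_apply (d : ℕ) (x : Fin (d - 1) → k) (i : Fin d) :
    ((preproj k d).α x : Fin d → k) i = if h : (i : ℕ) < d - 1 then x ⟨i, h⟩ else 0 := by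
  change ∑ j : Fin (d - 1), (if (i : ℕ) = j then (1 : k) else 0) • x j = _
  split_ifs with h
  · exact sum_ite_smul_eq (fun j : Fin (d - 1) => (i : ℕ) = j) x ⟨i, h⟩
      fun j => by rw [Fin.ext_iff]; exact eq_comm
  · exact sum_ite_smul_eq_zero _ _ fun j => by omega

theorem preproj_β_apply (d : ℕ) (x : Fin (d - 1) → k) (i : Fin d) :
    ((preproj k d).β x : Fin d → k) i =
      if h : 0 < (i : ℕ) then x ⟨i - 1, by omega⟩ else 0 := by
  change ∑ j : Fin (d - 1), (if (i : ℕ) = j + 1 then (1 : k) else 0) • x j = _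
  split_ifs with h
  · exact sum_ite_smul_eq (fun j : Fin (d - 1) => (i : ℕ) = j + 1) x ⟨i - 1, by omega⟩
      fun j => by simp only [Fin.ext_iff]; omega
  · exact sum_ite_smul_eq_zero _ _ fun j => by omega

theorem preproj_α_injective (d : ℕ) : Function.Injective (preproj k d).α := by
  rw [injective_iff_map_eq_zero]
  intro (x : Fin (d - 1) → k) hx
  funext i
  have h := (preproj_α_apply d x ⟨i, by omega⟩).symm.trans (congrFun hx ⟨i, by omega⟩)
  rwa [dif_pos i.2] at h

/-- Coordinate `i + 1` of the equation reads `x_i = c x_{i+1}`, with `0` in place of `x_{i+1}` past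
the end, so `x` vanishes from the last coordinate backwards. -/
theorem preproj_pencil_injective (d : ℕ) (c : k) {x : (preproj k d).V₁}
    (hx : (preproj k d).β x = c • (preproj k d).α x) : x = 0 := by
  change Fin (d - 1) → k at x
  have h : ∀ a i, (hi : i < d - 1) → i + a + 1 = d - 1 → x ⟨i, hi⟩ = 0 := by
    intro a
    induction a with
    | zero =>
      intro i hi ha
      have h := (preproj_β_apply d x ⟨i + 1, by omega⟩).symm.trans
        ((congrFun hx ⟨i + 1, by omega⟩).trans
          (congrArg (c • ·) (preproj_α_apply d x ⟨i + 1, by omega⟩)))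
      simpa [show ¬ i + 1 < d - 1 by omega] using h
    | succ a ih =>
      intro i hi ha
      have h := (preproj_β_apply d x ⟨i + 1, by omega⟩).symm.trans
        ((congrFun hx ⟨i + 1, by omega⟩).trans
          (congrArg (c • ·) (preproj_α_apply d x ⟨i + 1, by omega⟩)))
      simpa [show i + 1 < d - 1 by omega, ih (i + 1) (by omega) (by omega)] using h
  funext i
  exact h (d - 2 - i) i i.2 (by omega)

theorem preproj_β_injective (d : ℕ) : Function.Injective (preproj k d).β := by
  rw [injective_iff_map_eq_zero]
  intro x hx
  exact preproj_pencil_injective d 0 (by rw [hx, zero_smul])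

/-- Extension by zero embeds `P_n` into `P_d` for `n ≤ d`. -/
theorem exists_preproj_embedding {n d : ℕ} (h : n ≤ d) :
    ∃ f : Hom (preproj k n) (preproj k d), Function.Injective f.1.1 ∧ Function.Injective f.1.2 := by
  let z : ∀ m m' : ℕ, (Fin m → k) →ₗ[k] (Fin m' → k) := fun m m' =>
    LinearMap.pi fun i => if hi : (i : ℕ) < m then LinearMap.proj ⟨i, hi⟩ else 0
  have hz : ∀ m m' x i, z m m' x i = if hi : (i : ℕ) < m then x ⟨i, hi⟩ else 0 := by
    intro m m' x i
    simp only [z, LinearMap.pi_apply]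
    split_ifs <;> rfl
  have hinj : ∀ m m', m ≤ m' → Function.Injective (z m m') := by
    intro m m' hm x y hxy
    funext i
    simpa [hz] using congrFun hxy ⟨i, by omega⟩
  refine ⟨⟨(z (n - 1) (d - 1), z n d), ?_, ?_⟩, hinj _ _ (by omega), hinj _ _ h⟩
  · refine LinearMap.ext fun (x : Fin (n - 1) → k) => funext fun (i : Fin d) => ?_
    refine (hz n d _ i).trans (Eq.trans ?_ (preproj_α_apply d (z (n - 1) (d - 1) x) i).symm)
    by_cases hi : (i : ℕ) < n
    · rw [dif_pos hi]
      refine (preproj_α_apply n x ⟨i, hi⟩).trans ?_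
      simp only [hz]
      split_ifs <;> first | rfl | omega
    · rw [dif_neg hi]
      simp only [hz]
      split_ifs <;> first | rfl | omega
  · refine LinearMap.ext fun (x : Fin (n - 1) → k) => funext fun (i : Fin d) => ?_
    refine (hz n d _ i).trans (Eq.trans ?_ (preproj_β_apply d (z (n - 1) (d - 1) x) i).symm)
    by_cases hi : (i : ℕ) < n
    · rw [dif_pos hi]
      refine (preproj_β_apply n x ⟨i, hi⟩).trans ?_
      simp only [hz]
      split_ifs <;> first | rfl | omega
    · rw [dif_neg hi]
      simp only [hz]
      split_ifs <;> first | rfl | omega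

variable {V W : Type*} [AddCommGroup V] [Module k V] [AddCommGroup W] [Module k W]

theorem map_mulVecLin_single {d₁ d₂ : ℕ} (A : Matrix (Fin d₂) (Fin d₁) k)
    (f : (Fin d₂ → k) →ₗ[k] W) (j : Fin d₁) :
    f (A.mulVecLin (Pi.single j 1)) = ∑ i, A i j • f (Pi.single i 1) := by
  have h : A.mulVecLin (Pi.single j 1) = ∑ i, A i j • Pi.single i (1 : k) := by
    ext i
    simp [Finset.sum_apply, Pi.single_apply]
  simp [h]

/-- A morphism from `(E, B)`, with `B` upper triangular with constant diagonal `c`, to a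
representation on which the pencil `β - c α` is injective, is zero. -/
theorem eq_zero_of_upperTriangular {n : ℕ} (B : Matrix (Fin n) (Fin n) k) (c : k)
    (hlow : ∀ i j, j < i → B i j = 0) (hdiag : ∀ i, B i i = c) (α β : V →ₗ[k] W)
    (hinj : ∀ x, β x = c • α x → x = 0) (f₁ : (Fin n → k) →ₗ[k] V) (f₂ : (Fin n → k) →ₗ[k] W)
    (h₁ : f₂ ∘ₗ (1 : Matrix (Fin n) (Fin n) k).mulVecLin = α ∘ₗ f₁)
    (h₂ : f₂ ∘ₗ B.mulVecLin = β ∘ₗ f₁) : f₁ = 0 ∧ f₂ = 0 := by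
  rw [Matrix.mulVecLin_one, LinearMap.comp_id] at h₁
  have h : ∀ j, f₁ (Pi.single j 1) = 0 := by
    intro j
    induction j using WellFoundedLT.induction with
    | _ j ih =>
    -- In `β (f₁ e_j) = ∑ B_ij α (f₁ e_i)`, terms with `i < j` vanish by induction and those with `i
    -- > j` by triangularity, leaving `c α (f₁ e_j)`.
    apply hinj
    have h2 : f₂ (B.mulVecLin (Pi.single j 1)) = β (f₁ (Pi.single j 1)) := LinearMap.congr_fun h₂ _
    rw [← h2, map_mulVecLin_single, Finset.sum_eq_single j, hdiag, h₁, LinearMap.comp_apply]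
    · intro i _ hij
      rcases lt_or_gt_of_ne hij with hij | hij
      · rw [h₁, LinearMap.comp_apply, ih i hij, map_zero, smul_zero]
      · rw [hlow i j hij, zero_smul]
    · simp
  have hf : f₁ = 0 := LinearMap.pi_ext' fun j => LinearMap.ext_ring (by simpa using h j)
  exact ⟨hf, by rw [h₁, hf, LinearMap.comp_zero]⟩

/-- In `I_n` one has `β e₀ = 0` and `β e_{i+1} = α e_i`. As `β` is injective on `P_d`, the images of
the `e_i` vanish successively; `f₂` then vanishes because `α` is onto in `I_n`. -/
theorem hom_preinj_preproj_eq_zero {n d : ℕ} (f : Hom (preinj k n) (preproj k d)) : f = 0 := by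
  obtain ⟨⟨f₁, f₂⟩, h₁, h₂⟩ := f
  change (Fin n → k) →ₗ[k] _ at f₁
  change (Fin (n - 1) → k) →ₗ[k] _ at f₂
  have hα : ∀ (i : Fin n) (hi : (i : ℕ) < n - 1),
      (preproj k d).α (f₁ (Pi.single i 1)) = f₂ (Pi.single ⟨i, hi⟩ 1) := by
    intro i hi
    refine (LinearMap.congr_fun h₁ (Pi.single i 1)).symm.trans ((map_mulVecLin_single _ f₂ i).trans ?_)
    exact sum_ite_smul_eq (fun j : Fin (n - 1) => (i : ℕ) = j) _ ⟨i, hi⟩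
      fun j => by rw [Fin.ext_iff]; exact eq_comm
  have h : ∀ i (hi : i < n), f₁ (Pi.single ⟨i, hi⟩ 1) = 0 := by
    intro i
    induction i with
    | zero =>
      intro hi
      apply preproj_β_injective d
      rw [map_zero]
      refine (LinearMap.congr_fun h₂ (Pi.single _ 1)).symm.trans
        ((map_mulVecLin_single _ f₂ _).trans ?_)
      exact sum_ite_smul_eq_zero (fun j : Fin (n - 1) => 0 = (j : ℕ) + 1) _ fun j => by omega
    | succ i ih =>
      intro hi
      apply preproj_β_injective d
      rw [map_zero]
      refine (LinearMap.congr_fun h₂ (Pi.single _ 1)).symm.trans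
        ((map_mulVecLin_single _ f₂ _).trans ?_)
      refine (sum_ite_smul_eq (fun j : Fin (n - 1) => i + 1 = (j : ℕ) + 1) _ ⟨i, by omega⟩
        fun j => by simp [Fin.ext_iff, eq_comm]).trans ?_
      rw [← hα ⟨i, by omega⟩ (by change i < n - 1; omega), ih (by omega), map_zero]
  have hf₁ : f₁ = 0 := LinearMap.pi_ext' fun j => LinearMap.ext_ring (by simpa using h j j.2)
  have hf₂ : f₂ = 0 := LinearMap.pi_ext' fun j => LinearMap.ext_ring (by
    have := hα ⟨j, by omega⟩ j.2
    rw [h, map_zero] at this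
    simpa using this.symm)
  subst hf₁ hf₂
  rfl

theorem Label.hom_preproj_eq_zero (ℓ : Label k) (hℓ : ¬ ℓ.IsPreprojective) {d : ℕ}
    (f : Hom ℓ.rep (preproj k d)) : f = 0 := by
  cases ℓ with
  | P n => exact (hℓ trivial).elim
  | I n => exact hom_preinj_preproj_eq_zero f
  | R n c =>
    obtain ⟨⟨f₁, f₂⟩, h₁, h₂⟩ := f
    obtain ⟨rfl, rfl⟩ := eq_zero_of_upperTriangular (jordanCell n c) c
      (fun i j h => by simp [jordanCell, h.ne', show (j : ℕ) ≠ i + 1 by omega])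
      (fun i => by simp [jordanCell]) (preproj k d).α (preproj k d).β
      (fun x hx => preproj_pencil_injective d c hx) f₁ f₂ h₁ h₂
    rfl
  -- Exchanging `α` and `β` turns this into the case of eigenvalue `0`.
  | Rinfty n =>
    obtain ⟨⟨f₁, f₂⟩, h₁, h₂⟩ := f
    obtain ⟨rfl, rfl⟩ := eq_zero_of_upperTriangular (jordanCell n 0) 0
      (fun i j h => by simp [jordanCell, h.ne', show (j : ℕ) ≠ i + 1 by omega])
      (fun i => by simp [jordanCell]) (preproj k d).β (preproj k d).α
      (fun x hx => preproj_α_injective d (by rw [hx, zero_smul, map_zero])) f₁ f₂ h₂ h₁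
    rfl

theorem Label.exists_embedding_preproj (ℓ : Label k) (hℓ : ℓ.IsPreprojective) {d : ℕ}
    (hd : Module.finrank k ℓ.rep.V₂ ≤ d) : ∃ f : Hom ℓ.rep (preproj k d),
      Function.Injective f.1.1 ∧ Function.Injective f.1.2 := by
  cases ℓ with
  | P n =>
    refine exists_preproj_embedding ?_
    have : Module.finrank k (Fin n → k) ≤ d := hd
    simpa using this
  | I n => exact hℓ.elim
  | R n c => exact hℓ.elim
  | Rinfty n => exact hℓ.elim

end HomToPreprojective

/-! ### The reject and the three parts of `M`. -/

section Parts

variable {k : Type u} [Field k] {M : KroneckerRep.{u, v} k}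

theorem Subrep.iInf_U₁ {ι : Sort*} (N : ι → Subrep M) : (⨅ i, N i).U₁ = ⨅ i, (N i).U₁ := by
  change ⨅ L ∈ Set.range N, L.U₁ = _
  exact iInf_range

theorem Subrep.iInf_U₂ {ι : Sort*} (N : ι → Subrep M) : (⨅ i, N i).U₂ = ⨅ i, (N i).U₂ := by
  change ⨅ L ∈ Set.range N, L.U₂ = _
  exact iInf_range

theorem mem_reject_U₁ {U : KroneckerRep.{u, w} k} {x : M.V₁} :
    x ∈ (reject M U).U₁ ↔ ∀ f : Hom M U, f.1.1 x = 0 := by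
  simp [reject, Subrep.iInf_U₁, ker]

theorem mem_reject_U₂ {U : KroneckerRep.{u, w} k} {x : M.V₂} :
    x ∈ (reject M U).U₂ ↔ ∀ f : Hom M U, f.1.2 x = 0 := by
  simp [reject, Subrep.iInf_U₂, ker]

/-- Evaluation at `x` is linear in the morphism, so it vanishes once it vanishes on a basis. -/
theorem iInf_ker_basis_eq_reject {U : KroneckerRep.{u, w} k} {ι : Type*}
    (f : Module.Basis ι k (Hom M U)) : ⨅ i, ker (f i) = reject M U := by
  refine le_antisymm ?_ (le_iInf fun i => iInf_le _ _)
  refine ⟨fun x hx => mem_reject_U₁.2 fun g => ?_, fun x hx => mem_reject_U₂.2 fun g => ?_⟩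
  · simp only [Subrep.iInf_U₁, Submodule.mem_iInf] at hx
    let e : Hom M U →ₗ[k] U.V₁ := LinearMap.applyₗ x ∘ₗ LinearMap.fst k _ _ ∘ₗ (Hom M U).subtype
    have : e = 0 := f.ext hx
    exact LinearMap.congr_fun this g
  · simp only [Subrep.iInf_U₂, Submodule.mem_iInf] at hx
    let e : Hom M U →ₗ[k] U.V₂ := LinearMap.applyₗ x ∘ₗ LinearMap.snd k _ _ ∘ₗ (Hom M U).subtype
    have : e = 0 := f.ext hx
    exact LinearMap.congr_fun this g

theorem Subrep.mem_map_U₁ {M' : KroneckerRep.{u, w} k} (F : Iso M M') (N : Subrep M) {x : M'.V₁} :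
    x ∈ (N.map F).U₁ ↔ F.e₁.symm x ∈ N.U₁ :=
  Submodule.mem_map_equiv N.U₁

theorem Subrep.mem_map_U₂ {M' : KroneckerRep.{u, w} k} (F : Iso M M') (N : Subrep M) {x : M'.V₂} :
    x ∈ (N.map F).U₂ ↔ F.e₂.symm x ∈ N.U₂ :=
  Submodule.mem_map_equiv N.U₂

theorem Subrep.map_sup {M' : KroneckerRep.{u, w} k} (F : Iso M M') (N N' : Subrep M) :
    (N ⊔ N').map F = N.map F ⊔ N'.map F :=
  Subrep.ext (Submodule.map_sup _ _ _) (Submodule.map_sup _ _ _)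

theorem pi_apply_eq_zero_of_single {ι : Type*} [Fintype ι] [DecidableEq ι]
    {V : ι → Type*} [∀ i, AddCommGroup (V i)] [∀ i, Module k (V i)] {W : Type*} [AddCommGroup W]
    [Module k W] (f : (∀ i, V i) →ₗ[k] W) (x : ∀ i, V i) (h : ∀ i, f (Pi.single i (x i)) = 0) :
    f x = 0 := by
  rw [← LinearMap.sum_single_apply V x, map_sum]
  exact Finset.sum_eq_zero fun i _ => h i

theorem pi_bot_sup_pi_bot {ι : Type*} {V : ι → Type*} [∀ i, AddCommGroup (V i)]
    [∀ i, Module k (V i)] (S T : Set ι) :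
    (Submodule.pi Sᶜ fun i => (⊥ : Submodule k (V i))) ⊔ (Submodule.pi Tᶜ fun _ => ⊥) =
      Submodule.pi (S ∪ T)ᶜ fun _ => ⊥ := by
  classical
  apply le_antisymm
  · exact sup_le (fun x hx i hi => hx i fun h => hi (Or.inl h))
      fun x hx i hi => hx i fun h => hi (Or.inr h)
  · intro x hx
    rw [Submodule.mem_sup]
    refine ⟨S.piecewise x 0, fun i hi => by simp [Set.piecewise, show i ∉ S from hi],
      S.piecewise 0 x, fun i hi => ?_, ?_⟩
    · by_cases hS : i ∈ S
      · simp [Set.piecewise, hS]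
      · simpa [Set.piecewise, hS] using hx i (by simp_all)
    · funext i
      by_cases hS : i ∈ S <;> simp [Set.piecewise, hS]

variable {r : ℕ} (N : Fin r → KroneckerRep.{u, v} k)

theorem partialSum_sup (S T : Set (Fin r)) :
    partialSum N S ⊔ partialSum N T = partialSum N (S ∪ T) :=
  Subrep.ext (pi_bot_sup_pi_bot S T) (pi_bot_sup_pi_bot S T)

variable {N}

theorem disjoint_map_partialSum {M : KroneckerRep.{u, w} k} (F : Iso (directSum N) M)
    {S T : Set (Fin r)} (h : Disjoint S T) :
    Disjoint ((partialSum N S).map F) ((partialSum N T).map F) := by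
  have hj : ∀ j, j ∈ Sᶜ ∨ j ∈ Tᶜ := fun j => by
    by_contra! hj
    exact h.ne_of_mem (not_not.1 hj.1) (not_not.1 hj.2) rfl
  rw [disjoint_iff_inf_le]
  refine ⟨fun x hx => ?_, fun x hx => ?_⟩
  · have h1 := (Subrep.mem_map_U₁ F _).1 hx.1
    have h2 := (Subrep.mem_map_U₁ F _).1 hx.2
    refine (Submodule.mem_bot k).2 (F.e₁.symm.map_eq_zero_iff.1 (funext fun j => ?_))
    exact (hj j).elim (fun hj => h1 j hj) fun hj => h2 j hj
  · have h1 := (Subrep.mem_map_U₂ F _).1 hx.1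
    have h2 := (Subrep.mem_map_U₂ F _).1 hx.2
    refine (Submodule.mem_bot k).2 (F.e₂.symm.map_eq_zero_iff.1 (funext fun j => ?_))
    exact (hj j).elim (fun hj => h1 j hj) fun hj => h2 j hj

theorem isCompl_map_partialSum {M : KroneckerRep.{u, w} k} (F : Iso (directSum N) M)
    (S : Set (Fin r)) : IsCompl ((partialSum N S).map F) ((partialSum N Sᶜ).map F) := by
  refine ⟨disjoint_map_partialSum F disjoint_compl_right, ?_⟩
  rw [codisjoint_iff_le_sup, ← Subrep.map_sup, partialSum_sup, Set.union_compl_self]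
  exact ⟨fun x _ => (Subrep.mem_map_U₁ F _).2 fun j hj => (hj trivial).elim,
    fun x _ => (Subrep.mem_map_U₂ F _).2 fun j hj => (hj trivial).elim⟩

theorem Subrep.nonempty_iso_quotient {L K : Subrep M} (h : IsCompl L K) :
    Nonempty (Iso L.toRep (M.quotient K)) := by
  have h₁ : IsCompl K.U₁ L.U₁ := by
    refine (IsCompl.of_eq ?_ ?_).symm
    · exact congrArg Subrep.U₁ h.inf_eq_bot
    · exact congrArg Subrep.U₁ h.sup_eq_top
  have h₂ : IsCompl K.U₂ L.U₂ := by
    refine (IsCompl.of_eq ?_ ?_).symm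
    · exact congrArg Subrep.U₂ h.inf_eq_bot
    · exact congrArg Subrep.U₂ h.sup_eq_top
  -- These inverses are the quotient maps restricted to `L`, so they commute with the arrows by
  -- definition.
  exact ⟨⟨(K.U₁.quotientEquivOfIsCompl _ h₁).symm, (K.U₂.quotientEquivOfIsCompl _ h₂).symm,
    fun x => rfl, fun x => rfl⟩⟩

namespace Decomposition

variable (D : Decomposition M)

theorem regularPart_sup_preinjectivePart :
    D.regularPart ⊔ D.preinjectivePart =
      (partialSum (fun j => (D.label j).rep) {j | (D.label j).IsPreprojective}ᶜ).map D.F := by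
  rw [regularPart, preinjectivePart, ← Subrep.map_sup, partialSum_sup]
  congr 2
  ext j
  cases h : D.label j <;> simp [h, Label.IsRegular, Label.IsPreinjective, Label.IsPreprojective]

theorem disjoint_regularPart_preinjectivePart :
    Disjoint D.regularPart D.preinjectivePart := by
  refine disjoint_map_partialSum D.F (Set.disjoint_left.2 fun j => ?_)
  cases h : D.label j <;> simp [h, Label.IsRegular, Label.IsPreinjective]

theorem isCompl_preprojectivePart :
    IsCompl D.preprojectivePart (D.regularPart ⊔ D.preinjectivePart) := by
  rw [regularPart_sup_preinjectivePart]
  exact isCompl_map_partialSum D.F _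

/-- The morphism out of `M` that restricts to a given morphism on one summand and vanishes on the
others. -/
def homOfSummand {U : KroneckerRep.{u, w} k} (j : Fin D.r) (f : Hom (D.label j).rep U) :
    Hom M U :=
  ⟨(f.1.1 ∘ₗ LinearMap.proj j ∘ₗ D.F.e₁.symm.toLinearMap,
    f.1.2 ∘ₗ LinearMap.proj j ∘ₗ D.F.e₂.symm.toLinearMap), by
    constructor
    · refine LinearMap.ext fun x => ?_
      have h : D.F.e₂.symm (M.α x) = (directSum _).α (D.F.e₁.symm x) := by
        rw [LinearEquiv.symm_apply_eq, D.F.comm_α, LinearEquiv.apply_symm_apply]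
      exact (congrArg (fun y => f.1.2 (y j)) h).trans (LinearMap.congr_fun f.2.1 _)
    · refine LinearMap.ext fun x => ?_
      have h : D.F.e₂.symm (M.β x) = (directSum _).β (D.F.e₁.symm x) := by
        rw [LinearEquiv.symm_apply_eq, D.F.comm_β, LinearEquiv.apply_symm_apply]
      exact (congrArg (fun y => f.1.2 (y j)) h).trans (LinearMap.congr_fun f.2.2 _)⟩

/-- The restriction of a morphism out of `M` to one summand. -/
def restrictSummand {U : KroneckerRep.{u, w} k} (j : Fin D.r) (f : Hom M U) :
    Hom (D.label j).rep U :=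
  ⟨(f.1.1 ∘ₗ D.F.e₁.toLinearMap ∘ₗ LinearMap.single k (fun j => (D.label j).rep.V₁) j,
    f.1.2 ∘ₗ D.F.e₂.toLinearMap ∘ₗ LinearMap.single k (fun j => (D.label j).rep.V₂) j), by
    constructor
    · refine LinearMap.ext fun x => ?_
      have h : (directSum fun j => (D.label j).rep).α (Pi.single j x) =
          Pi.single j ((D.label j).rep.α x) :=
        funext fun i => Pi.apply_single (fun i => (D.label i).rep.α) (fun i => map_zero _) j x i
      exact (congrArg f.1.2 ((congrArg D.F.e₂ h).symm.trans (D.F.comm_α _))).trans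
        (LinearMap.congr_fun f.2.1 _)
    · refine LinearMap.ext fun x => ?_
      have h : (directSum fun j => (D.label j).rep).β (Pi.single j x) =
          Pi.single j ((D.label j).rep.β x) :=
        funext fun i => Pi.apply_single (fun i => (D.label i).rep.β) (fun i => map_zero _) j x i
      exact (congrArg f.1.2 ((congrArg D.F.e₂ h).symm.trans (D.F.comm_β _))).trans
        (LinearMap.congr_fun f.2.2 _)⟩

/-- This is why `d₂` is large enough: a summand `P_n` has `n = dim P_n(2) ≤ dim M(2)`. -/
theorem finrank_summand_le (j : Fin D.r) :
    Module.finrank k (D.label j).rep.V₂ ≤ Module.finrank k M.V₂ := by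
  refine LinearMap.finrank_le_finrank_of_injective
    (f := D.F.e₂.toLinearMap ∘ₗ LinearMap.single k (fun j => (D.label j).rep.V₂) j) ?_
  exact D.F.e₂.injective.comp
    (Pi.single_injective (M := fun j => (D.label j).rep.V₂) j)

/-- A nonzero preprojective component is detected by projecting to its summand and embedding that
into `P_d`; on every other summand all morphisms to `P_d` vanish. -/
theorem reject_preproj_eq {d : ℕ} (hd : Module.finrank k M.V₂ ≤ d) :
    reject M (preproj k d) = D.regularPart ⊔ D.preinjectivePart := by
  rw [regularPart_sup_preinjectivePart]
  apply le_antisymm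
  · refine ⟨fun x hx => (Subrep.mem_map_U₁ _ _).2 fun j hj => ?_,
      fun x hx => (Subrep.mem_map_U₂ _ _).2 fun j hj => ?_⟩
    · obtain ⟨f, hf, -⟩ := (D.label j).exists_embedding_preproj (not_not.1 hj)
        ((D.finrank_summand_le j).trans hd)
      exact hf ((mem_reject_U₁.1 hx (D.homOfSummand j f)).trans (map_zero _).symm)
    · obtain ⟨f, -, hf⟩ := (D.label j).exists_embedding_preproj (not_not.1 hj)
        ((D.finrank_summand_le j).trans hd)
      exact hf ((mem_reject_U₂.1 hx (D.homOfSummand j f)).trans (map_zero _).symm)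
  · constructor
    · rintro _ ⟨x, hx, rfl⟩
      refine mem_reject_U₁.2 fun f => ?_
      refine pi_apply_eq_zero_of_single (V := fun j => (D.label j).rep.V₁)
        (f.1.1 ∘ₗ D.F.e₁.toLinearMap) x fun j => ?_
      by_cases hj : (D.label j).IsPreprojective
      · have : x j = 0 := hx j (not_not.2 hj)
        rw [this, Pi.single_zero, map_zero]
      · have := (D.label j).hom_preproj_eq_zero hj (D.restrictSummand j f)
        exact LinearMap.congr_fun (congrArg (fun g => g.1.1) this) (x j)
    · rintro _ ⟨x, hx, rfl⟩
      refine mem_reject_U₂.2 fun f => ?_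
      refine pi_apply_eq_zero_of_single (V := fun j => (D.label j).rep.V₂)
        (f.1.2 ∘ₗ D.F.e₂.toLinearMap) x fun j => ?_
      by_cases hj : (D.label j).IsPreprojective
      · have : x j = 0 := hx j (not_not.2 hj)
        rw [this, Pi.single_zero, map_zero]
      · have := (D.label j).hom_preproj_eq_zero hj (D.restrictSummand j f)
        exact LinearMap.congr_fun (congrArg (fun g => g.1.2) this) (x j)

end Decomposition

end Parts

end KroneckerRep

open KroneckerRep in
/-- Every Kronecker module `M` over an algebraically closed field has an indecomposable
decomposition, so the parts `P_M`, `R_M`, `I_M` exist; and for every decomposition and every basis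
`f₁, …, f_a` of `Hom(M, P_{d₂})`, where `d₂ = dim M(2)`, the claim holds. -/
theorem proposition5p2 {k : Type u} [Field k] [IsAlgClosed k] (M : KroneckerRep.{u, v} k) :
    Nonempty (Decomposition M) ∧
    ∀ (D : Decomposition M) (a : ℕ)
      (f : Module.Basis (Fin a) k (Hom M (preproj k (Module.finrank k M.V₂)))),
      (⨅ i, ker (f i)) = reject M (preproj k (Module.finrank k M.V₂)) ∧
      (⨅ i, ker (f i)) = D.regularPart ⊔ D.preinjectivePart ∧
      Disjoint D.regularPart D.preinjectivePart ∧
      IsCompl D.preprojectivePart (D.regularPart ⊔ D.preinjectivePart) ∧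
      Nonempty (Iso D.preprojectivePart.toRep (M.quotient (⨅ i, ker (f i)))) := by
  refine ⟨nonempty_decomposition M, fun D a f => ?_⟩
  have h := (iInf_ker_basis_eq_reject f).trans (D.reject_preproj_eq le_rfl)
  refine ⟨iInf_ker_basis_eq_reject f, h, D.disjoint_regularPart_preinjectivePart,
    D.isCompl_preprojectivePart, ?_⟩
  rw [h]
  exact Subrep.nonempty_iso_quotient D.isCompl_preprojectivePart
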